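/- **Theorem 1.2.** For graphs $H_1,H_2$, call a graph $G$ $(H_1,H_2)$-free if its edges can be coloured with two colours so that, for each $i\in\{1,2\}$, the spanning subgraph formed by the edges of colour $i$ contains no copy of $H_i$. For real $m$, let $RT(n,H_1,H_2,m)$ be the maximum number of edges of an $n$-vertex $(H_1,H_2)$-free graph with independence number at most $m$. Let $R(3,s)$ be the least $N$ such that every blue/red colouring of the edges of $K_N$ contains a blue $K_3$ or a red $K_s$. Let $s\ge 2$ be an integer, let $\omega(n)$ be a real function with $\omega(n)\to\infty$ and $\omega(n)=o\big((\log n)^{1/s}\big)$ as $n\to\infty$, and set $$g_s(n)=\frac{n}{e^{\omega(n)(\log n)^{1-1/s}}}.$$ (The growth condition on $\omega$ says exactly that $g_s(n)/n^{1-\varepsilon}\to\infty$ for every fixed $\varepsilon>0$.) Then, as $n\to\infty$, $$RT(n,K_3,K_{2s-1},g_s(n))=\frac12\Big(1-\frac1{R(3,s)-1}\Big)n^2+o(n^2)$$ and $$RT(n,K_3,K_{2s},g_s(n))=\frac12\Big(1-\frac1{R(3,s)}\Big)n^2+o(n^2).$$ -/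

import Mathlib

open Filter Asymptotics

namespace RamseyTuran

/-- `G` is `(H₁, …, H_k)`-free: the edges of `G` can be coloured with `k` colours (an arbitrary
colouring of the edge set, not a proper one) so that, for every colour `i`, the spanning subgraph
formed by the edges of colour `i` contains no copy of `H i`. -/
def MulticolourFree {k : ℕ} {W : Fin k → Type} (H : ∀ i, SimpleGraph (W i))
    {V : Type} (G : SimpleGraph V) : Prop :=
  ∃ φ : G.EdgeLabeling (Fin k), ∀ i, (H i).Free (φ.labelGraph i)

/-- The multicolour Ramsey–Turán number `RT(n, H₁, …, H_k, m)`: the maximum number of edges of an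
`n`-vertex `(H₁, …, H_k)`-free graph with independence number at most the real number `m`. -/
noncomputable def RT (n : ℕ) {k : ℕ} {W : Fin k → Type} (H : ∀ i, SimpleGraph (W i))
    (m : ℝ) : ℕ :=
  sSup {e : ℕ | ∃ G : SimpleGraph (Fin n),
    MulticolourFree H G ∧ (G.indepNum : ℝ) ≤ m ∧ G.edgeSet.ncard = e}

/-- The pair of complete graphs `(K_a, K_b)`, as a family indexed by the two colours. -/
def cliquePair (a b : ℕ) (i : Fin 2) : SimpleGraph (Fin (![a, b] i)) :=
  SimpleGraph.completeGraph (Fin (![a, b] i))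

/-- The Ramsey number `R(a, b)`: the least `N` such that every colouring of the edges of `K_N`
with the colours `0` and `1` contains a `K_a` of colour `0` or a `K_b` of colour `1`. -/
noncomputable def ramseyNumber (a b : ℕ) : ℕ :=
  sInf {N : ℕ | ∀ φ : SimpleGraph.TopEdgeLabeling (Fin N) (Fin 2),
    ¬ (φ.labelGraph 0).CliqueFree a ∨ ¬ (φ.labelGraph 1).CliqueFree b}

/-- The function `g_s^ω(n) = n / exp (ω(n) * (log n)^(1 - 1/s))`. -/
noncomputable def gFun (ω : ℕ → ℝ) (s n : ℕ) : ℝ :=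
  (n : ℝ) / Real.exp (ω n * Real.log n ^ (1 - 1 / (s : ℝ)))

end RamseyTuran

/-! ### Ramsey numbers R(3,s) and weighted independent sets. -/

namespace RamseyTuran

open SimpleGraph Finset

/-! Put r = R(3,s) + e - 1, with e = 0 for K_{2s-1} and e = 1 for K_{2s}. Both formulas then say
that the extremal density is that of the r-partite Turán graph.

Upper bound (`eventually_card_adj_lt`). Above this density a positive proportion of (r+1)-tuples
span cliques, and by pigeonhole many of them share one blue pattern P, a triangle-free graph on
R(3,s) + e vertices. By `exists_weighted_indep`, P has a set Q of non-isolated vertices and a set A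
of isolated ones such that Q ∪ A is independent and 2|Q| + |A| ≥ 2s - 1 + e. Fix the coordinates
outside Q. The candidates for a vertex of Q now lie in the blue neighbourhood of a fixed vertex, so
more of them than the independence number must span a red edge. Iterated dependent random choice
(`exists_doubled_tuple`) doubles every vertex of Q into a red edge, which gives a red clique of
order 2|Q| + |A|. Since |Q| ≤ s, this works down to independence number n / exp(K (log n)^(1-1/s)),
and ω eventually exceeds K.

Lower bound (`exists_turanGraph_le`). Blow up an extremal colouring on R(3,s) - 1 vertices, add e
parts joined in red to all others, and put inside the parts a triangle-free graph of polynomially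
small independence number: red in the old parts, blue in the added ones. A red clique meets at most
s - 1 old parts, each in at most two vertices, and each added part at most once. The triangle-free
graph comes from far-apart points of the Boolean cube. -/

theorem forall_topEdgeLabeling_iff {V : Type} (p : SimpleGraph V → SimpleGraph V → Prop) :
    (∀ φ : TopEdgeLabeling V (Fin 2), p (φ.labelGraph 0) (φ.labelGraph 1)) ↔
      ∀ B : SimpleGraph V, p B Bᶜ := by
  classical
  constructor
  · intro h B
    have := h (toTopEdgeLabeling Bᶜ)
    rwa [toTopEdgeLabeling_labelGraph, toTopEdgeLabeling_labelGraph_compl, compl_compl] at this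
  · intro h φ
    have h1 : φ.labelGraph 0 = (φ.labelGraph 1)ᶜ := by
      rw [← toTopEdgeLabeling_labelGraph_compl, TopEdgeLabeling.labelGraph_toTopEdgeLabeling]
    have := h (φ.labelGraph 0)
    rwa [h1, compl_compl, ← h1] at this

theorem ramseyNumber_eq (a b : ℕ) : ramseyNumber a b = sInf {N : ℕ | ∀ B : SimpleGraph (Fin N),
    ¬ B.CliqueFree a ∨ ¬ Bᶜ.CliqueFree b} := by
  unfold ramseyNumber
  congr 1
  ext N
  exact forall_topEdgeLabeling_iff fun B C : SimpleGraph (Fin N) =>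
    ¬ B.CliqueFree a ∨ ¬ C.CliqueFree b

/-- A triangle-free graph on sufficiently many vertices has an independent set of size `s`. -/
theorem exists_isNClique_compl_of_sq_le {V : Type*} [DecidableEq V] (B : SimpleGraph V)
    (hB : B.CliqueFree 3) (s : ℕ) : ∀ T : Finset V, s * s ≤ #T →
      ∃ K ⊆ T, Bᶜ.IsNClique s K := by
  classical
  induction s with
  | zero => exact fun T _ => ⟨∅, by simp, by simp⟩
  | succ s ih =>
    intro T hT
    obtain ⟨v, hv⟩ : T.Nonempty := by
      rw [← Finset.card_pos]; nlinarith
    set D := T.filter (B.Adj v) with hD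
    by_cases hs : s + 1 ≤ #D
    · obtain ⟨K, hK, hKc⟩ := Finset.exists_subset_card_eq hs
      refine ⟨K, hK.trans (filter_subset _ _), ?_, hKc⟩
      intro x hx y hy hxy
      have hx' := (mem_filter.1 (hK hx)).2
      have hy' := (mem_filter.1 (hK hy)).2
      rw [compl_adj]
      refine ⟨hxy, fun h => ?_⟩
      exact hB {v, x, y} (is3Clique_triple_iff.2 ⟨hx', hy', h⟩)
    -- Deleting `v` and its at most `s` neighbours leaves at least s² vertices.
    · obtain ⟨K, hK, hKc⟩ := ih ((T \ D).erase v) (by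
        have h1 := Finset.card_sdiff_add_card_eq_card (filter_subset (B.Adj v) T)
        have h2 := Finset.pred_card_le_card_erase (s := T \ D) (a := v)
        have : (s + 1) * (s + 1) = s * s + 2 * s + 1 := by ring
        rw [← hD] at h1
        omega)
      refine ⟨insert v K, ?_, hKc.insert ?_⟩
      · refine insert_subset hv (hK.trans ((erase_subset _ _).trans sdiff_subset))
      · intro b hb
        have := hK hb
        simp only [Finset.mem_erase, Finset.mem_sdiff, hD, Finset.mem_filter, not_and] at this
        exact (compl_adj _ _ _).2 ⟨this.1.symm, this.2.2 this.2.1⟩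

/-- The bound s² shows that the infimum is attained; the property then passes to larger sets through
an embedding. -/
theorem ramseyNumber_spec {V : Type*} [DecidableEq V] (B : SimpleGraph V)
    (hB : B.CliqueFree 3) (s : ℕ) (T : Finset V) (hT : ramseyNumber 3 s ≤ #T) :
    ∃ K ⊆ T, Bᶜ.IsNClique s K := by
  classical
  have hne : {N : ℕ | ∀ B : SimpleGraph (Fin N), ¬ B.CliqueFree 3 ∨ ¬ Bᶜ.CliqueFree s}.Nonempty := by
    refine ⟨s * s, fun B => ?_⟩
    by_contra! h
    obtain ⟨K, -, hK⟩ := exists_isNClique_compl_of_sq_le B h.1 s univ (by simp)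
    exact h.2 K hK
  have hmem := Nat.sInf_mem hne
  rw [← ramseyNumber_eq] at hmem
  obtain ⟨T', hT', hc⟩ := Finset.exists_subset_card_eq hT
  let f : Fin (ramseyNumber 3 s) ↪ V := (T'.equivFinOfCardEq hc).symm.toEmbedding.trans
    (Function.Embedding.subtype _)
  have hf : ∀ i, f i ∈ T := fun i => hT' (Subtype.coe_prop _)
  have h := (hmem (B.comap f)).resolve_left (not_not_intro
    (hB.comap (SimpleGraph.Embedding.comap f B).isContained))
  simp only [CliqueFree, not_forall, not_not] at h
  obtain ⟨K, hK⟩ := h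
  refine ⟨K.map f, ?_, ?_, by simp [hK.2]⟩
  · intro x hx
    obtain ⟨i, -, rfl⟩ := Finset.mem_map.1 hx
    exact hf i
  · intro x hx y hy hxy
    obtain ⟨i, hi, rfl⟩ := Finset.mem_map.1 hx
    obtain ⟨j, hj, rfl⟩ := Finset.mem_map.1 hy
    have := hK.1 hi hj (fun h => hxy (h ▸ rfl))
    rw [compl_adj] at this ⊢
    exact ⟨hxy, this.2⟩

theorem exists_of_lt_ramseyNumber {N s : ℕ} (h : N < ramseyNumber 3 s) :
    ∃ B : SimpleGraph (Fin N), B.CliqueFree 3 ∧ Bᶜ.CliqueFree s := by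
  rw [ramseyNumber_eq] at h
  have := Nat.notMem_of_lt_sInf h
  simp only [Set.mem_ofPred_eq, not_forall, not_or, not_not] at this
  exact this

theorem ramseyNumber_pos {s : ℕ} (hs : 1 ≤ s) : 1 ≤ ramseyNumber 3 s := by
  by_contra! h
  obtain ⟨K, hK, hK'⟩ := ramseyNumber_spec (⊥ : SimpleGraph ℕ) (cliqueFree_bot (by norm_num)) s ∅
    (by simp; omega)
  have := hK'.2
  rw [subset_empty.1 hK] at this
  simp at this; omega

/-- A disjoint edge added to an extremal triangle-free graph creates no triangle and raises the
independence number by at most one. -/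
theorem ramseyNumber_add_two_le {s : ℕ} (hs : 1 ≤ s) :
    ramseyNumber 3 s + 2 ≤ ramseyNumber 3 (s + 1) := by
  classical
  have hpos := ramseyNumber_pos hs
  by_contra! h
  obtain ⟨N, hN⟩ : ∃ N, N + 1 = ramseyNumber 3 s := ⟨ramseyNumber 3 s - 1, by omega⟩
  obtain ⟨B, hB3, hBs⟩ := exists_of_lt_ramseyNumber (N := N) (s := s) (by omega)
  let C : SimpleGraph (Fin N ⊕ Fin 2) := B ⊕g (⊤ : SimpleGraph (Fin 2))
  have hC : C.CliqueFree 3 := by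
    intro K hK
    obtain ⟨a, b, c, hab, hac, hbc, -⟩ := is3Clique_iff.1 hK
    rcases a with a | a <;> rcases b with b | b <;> rcases c with c | c <;>
      simp [C] at hab hac hbc
    · exact hB3 {a, b, c} (is3Clique_triple_iff.2 ⟨hab, hac, hbc⟩)
    · omega
  obtain ⟨K, -, hK⟩ := ramseyNumber_spec C hC (s + 1) univ (by simp; omega)
  have hl : #K.toLeft < s := by
    by_contra! h
    obtain ⟨K', hK', hc⟩ := Finset.exists_subset_card_eq h
    refine hBs K' ⟨fun x hx y hy hxy => ?_, hc⟩
    have := hK.1 (mem_toLeft.1 (hK' hx)) (mem_toLeft.1 (hK' hy)) (by simpa using hxy)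
    simpa [C] using this
  have hr : #K.toRight ≤ 1 := by
    rw [Finset.card_le_one]
    intro x hx y hy
    by_contra hxy
    have := hK.1 (mem_toRight.1 hx) (mem_toRight.1 hy) (by simpa using hxy)
    simp [C, hxy] at this
  have := hK.2
  rw [← card_toLeft_add_card_toRight] at this
  omega

theorem ramseyNumber_add_two_mul_le (s k : ℕ) (hs : 1 ≤ s) :
    ramseyNumber 3 s + 2 * k ≤ ramseyNumber 3 (s + k) := by
  induction k with
  | zero => simp
  | succ k ih =>
    have := ramseyNumber_add_two_le (s := s + k) (by omega)
    rw [← add_assoc]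
    omega

theorem three_le_ramseyNumber {s : ℕ} (hs : 2 ≤ s) : 3 ≤ ramseyNumber 3 s := by
  have h1 := ramseyNumber_add_two_mul_le 1 (s - 1) le_rfl
  have h2 := ramseyNumber_pos (s := 1) le_rfl
  rw [show 1 + (s - 1) = s by omega] at h1
  omega

/-- In a triangle-free graph there are an independent set `Q` of non-isolated vertices and a set
`A` of isolated vertices, with `2 |Q| + |A|` large. -/
theorem exists_weighted_indep {V : Type*} [Fintype V] [DecidableEq V] (B : SimpleGraph V)
    (hB : B.CliqueFree 3) (s e : ℕ) (hs : 1 ≤ s) (he : e ≤ 1)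
    (hV : ramseyNumber 3 s + e ≤ Fintype.card V) :
    ∃ Q A : Finset V, Disjoint Q A ∧ (∀ x ∈ Q ∪ A, ∀ y ∈ Q ∪ A, ¬ B.Adj x y) ∧
      (∀ x ∈ Q, ∃ y, B.Adj x y) ∧ #Q ≤ s ∧ 2 * s - 1 + e ≤ 2 * #Q + #A := by
  classical
  set A : Finset V := univ.filter fun v => ∀ w, ¬ B.Adj v w with hA
  have hAadj : ∀ x ∈ A, ∀ y, ¬ B.Adj x y := fun x hx => (mem_filter.1 hx).2
  by_cases h : 2 * s - 1 + e ≤ #A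
  · refine ⟨∅, A, disjoint_empty_left _, ?_, by simp, by simp, by simpa using h⟩
    intro x hx y _
    exact hAadj x (by simpa using hx) y
  -- Two isolated vertices pay for one vertex of `Q`: discarding `A` costs |A| vertices, while
  -- lowering `s` by j lowers the Ramsey number by at least 2j. The rounding of j accounts for `e`.
  · have h1 := ramseyNumber_add_two_mul_le (s - (#A + 1 - e) / 2) ((#A + 1 - e) / 2) (by omega)
    rw [Nat.sub_add_cancel (by omega)] at h1
    have h2 := card_compl_add_card A
    obtain ⟨Q, hQ, hQc⟩ := ramseyNumber_spec B hB (s - (#A + 1 - e) / 2) Aᶜ (by omega)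
    refine ⟨Q, A, ?_, ?_, ?_, ?_, ?_⟩
    · exact disjoint_left.2 fun x hx => mem_compl.1 (hQ hx)
    · intro x hx y hy hxy
      rcases mem_union.1 hx with hx | hx
      · rcases mem_union.1 hy with hy | hy
        · exact ((compl_adj _ _ _).1 (hQc.1 hx hy hxy.ne)).2 hxy
        · exact hAadj y hy x hxy.symm
      · exact hAadj x hx y hxy
    · intro x hx
      have := mem_compl.1 (hQ hx)
      simpa [hA] using this
    · rw [hQc.2]; omega
    · rw [hQc.2]; omega

/-! ### Counting tuples, and supersaturation. -/

/-- Exchanging the coordinates in the range of an injection `φ : ι ↪ κ`. -/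
noncomputable def exchangeEquiv {ι κ : Type*} (V : Type*) (φ : ι ↪ κ) :
    (κ → V) × (ι → V) ≃ (κ → V) × (ι → V) :=
  Function.Involutive.toPerm (fun p => (Function.extend φ p.2 p.1, p.1 ∘ φ)) (by
    rintro ⟨z, x⟩
    refine Prod.ext ?_ ?_
    · funext k
      by_cases h : ∃ i, φ i = k
      · obtain ⟨i, rfl⟩ := h
        simp [φ.injective.extend_apply]
      · simp [Function.extend_apply' _ _ _ h]
    · funext i
      simp [φ.injective.extend_apply])

theorem exchangeEquiv_apply {ι κ V : Type*} (φ : ι ↪ κ) (p : (κ → V) × (ι → V)) :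
    exchangeEquiv V φ p = (Function.extend φ p.2 p.1, p.1 ∘ φ) := rfl

section Counting
variable {ι κ V : Type*} [Fintype ι] [Fintype κ] [Fintype V] [DecidableEq ι] [DecidableEq κ]

-- The exchange is a bijection whose first component is the extended tuple, so overwriting
-- coordinates by independent uniform ones preserves the uniform distribution.
open Classical in
theorem card_filter_extend (φ : ι ↪ κ) (S : (κ → V) → Prop) :
    #{p : (κ → V) × (ι → V) | S (Function.extend φ p.2 p.1)} =
      #{f : κ → V | S f} * Fintype.card V ^ Fintype.card ι := by
  rw [← Fintype.card_fun, ← Finset.card_univ, ← Finset.card_product]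
  refine Finset.card_equiv (exchangeEquiv V φ) fun p => ?_
  simp [exchangeEquiv_apply]

open Classical in
theorem card_filter_comp (φ : ι ↪ κ) (S : (ι → V) → Prop) :
    #{f : κ → V | S (f ∘ φ)} * Fintype.card V ^ Fintype.card ι =
      #{x : ι → V | S x} * Fintype.card V ^ Fintype.card κ := by
  rw [← Fintype.card_fun, ← Finset.card_univ, ← Finset.card_product, mul_comm,
    ← Fintype.card_fun, ← Finset.card_univ, ← Finset.card_product]
  refine (Finset.card_equiv ((exchangeEquiv V φ)) fun p => ?_)
  have : (Function.extend φ p.2 p.1) ∘ φ = p.2 := by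
    funext i; simp [φ.injective.extend_apply]
  simp [exchangeEquiv_apply]

open Classical in
/-- Averaging: some choice of the coordinates outside the range of `φ` keeps the density. -/
theorem exists_le_card_filter_extend [Nonempty V] (φ : ι ↪ κ) (S : (κ → V) → Prop) (c : ℝ)
    (hS : c * (Fintype.card V : ℝ) ^ Fintype.card κ ≤ #{f : κ → V | S f}) :
    ∃ z : κ → V, c * (Fintype.card V : ℝ) ^ Fintype.card ι ≤
      #{x : ι → V | S (Function.extend φ x z)} := by
  by_contra! h
  have h1 := Finset.sum_lt_sum_of_nonempty (univ_nonempty (α := κ → V)) fun z _ => h z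
  have h2 := card_filter_extend φ S
  have h3 : #{p : (κ → V) × (ι → V) | S (Function.extend φ p.2 p.1)} =
      ∑ z : κ → V, #{x : ι → V | S (Function.extend φ x z)} := by
    simp only [Finset.card_filter]
    rw [Fintype.sum_prod_type]
  rw [← Nat.cast_sum, ← h3, h2] at h1
  simp only [sum_const, nsmul_eq_mul, Finset.card_univ, Fintype.card_fun] at h1
  push_cast at h1
  have h4 : (0 : ℝ) < (Fintype.card V : ℝ) ^ Fintype.card ι := by
    have := Fintype.card_pos (α := V); positivity
  nlinarith

end Counting

theorem two_mul_card_edgeFinset_le_of_cliqueFree {V : Type*} [Fintype V] (G : SimpleGraph V)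
    [DecidableRel G.Adj] {r : ℕ} (hr : 0 < r) (hG : G.CliqueFree (r + 1)) :
    (2 * #G.edgeFinset : ℝ) ≤ (1 - 1 / r) * (Fintype.card V : ℝ) ^ 2 := by
  obtain ⟨H, _, hH⟩ := exists_isTuranMaximal (V := V) hr
  have h1 := hH.2 hG
  rw [((isTuranMaximal_iff_nonempty_iso_turanGraph hr).mp hH).some.card_edgeFinset_eq] at h1
  have h2 := mul_card_edgeFinset_turanGraph_le (n := Fintype.card V) (r := r)
  have h3 : 2 * r * #G.edgeFinset ≤ (r - 1) * Fintype.card V ^ 2 := (by gcongr : _ ≤ _).trans h2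
  have h4 : (2 * r * #G.edgeFinset : ℝ) ≤ (r - 1) * (Fintype.card V : ℝ) ^ 2 := by
    have := (Nat.cast_le (α := ℝ)).2 h3
    push_cast [Nat.cast_sub (show 1 ≤ r from hr)] at this
    exact this
  have h5 : (0 : ℝ) < r := by exact_mod_cast hr
  rw [show (1 - 1 / (r : ℝ)) * (Fintype.card V : ℝ) ^ 2 = (r - 1) * (Fintype.card V : ℝ) ^ 2 / r by
    field_simp, le_div_iff₀ h5]
  linarith

open Classical in
/-- Supersaturation for complete graphs. -/
theorem exists_le_card_hom_top {r : ℕ} (hr : 0 < r) {ε : ℝ} (hε : 0 < ε) :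
    ∃ c : ℝ, 0 < c ∧ ∀ (V : Type) [Fintype V] [Nonempty V] (G : SimpleGraph V),
      (1 - 1 / (r : ℝ) + ε) * (Fintype.card V : ℝ) ^ 2 ≤ #{p : V × V | G.Adj p.1 p.2} →
      c * (Fintype.card V : ℝ) ^ (r + 1) ≤
        #{h : Fin (r + 1) → V | ∀ i j, i ≠ j → G.Adj (h i) (h j)} := by
  -- Sample `M`-tuples, with `M` so large that the pairs on the diagonal cost at most half of the
  -- excess ε.
  obtain ⟨M, hM⟩ := exists_nat_ge (2 * (1 + ε) / ε)
  have hM0 : (0 : ℝ) < M := lt_of_lt_of_le (by positivity) hM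
  rw [div_le_iff₀ hε] at hM
  refine ⟨ε / (2 * (Fintype.card (Fin (r + 1) ↪ Fin M) + 1)), by positivity, ?_⟩
  intro V _ _ G hG
  set n : ℝ := (Fintype.card V : ℝ) with hn
  have hn0 : 0 < n := by
    have := Fintype.card_pos (α := V)
    rw [hn]; exact_mod_cast this
  set θ : ℝ := 1 - 1 / (r : ℝ) + ε with hθ
  have hr1 : (0 : ℝ) ≤ 1 - 1 / (r : ℝ) := by
    have : (1 : ℝ) ≤ r := by exact_mod_cast hr
    rw [sub_nonneg, div_le_one (by positivity)]; exact this
  have hr2 : 1 - 1 / (r : ℝ) ≤ 1 := by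
    have : (0 : ℝ) ≤ 1 / r := by positivity
    linarith
  have hpair : ∀ p : Fin M × Fin M, p.1 ≠ p.2 →
      θ * n ^ M ≤ #{f : Fin M → V | G.Adj (f p.1) (f p.2)} := by
    intro p hp
    have hinj : Function.Injective ![p.1, p.2] := by
      intro i j
      fin_cases i <;> fin_cases j <;> simp [hp, hp.symm]
    have h1 := card_filter_comp (V := V) ⟨![p.1, p.2], hinj⟩ (fun x => G.Adj (x 0) (x 1))
    have h2 : #{x : Fin 2 → V | G.Adj (x 0) (x 1)} = #{p : V × V | G.Adj p.1 p.2} :=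
      Finset.card_equiv (finTwoArrowEquiv V) fun x => by simp [finTwoArrowEquiv]
    rw [h2] at h1
    have h3 := congrArg (Nat.cast (R := ℝ)) h1
    simp only [Function.Embedding.coeFn_mk, Function.comp_apply, Matrix.cons_val_zero,
      Matrix.cons_val_one, Fintype.card_fin, Nat.cast_mul, Nat.cast_pow] at h3
    have h4 : θ * n ^ M * n ^ 2 ≤ #{f : Fin M → V | G.Adj (f p.1) (f p.2)} * n ^ 2 := by
      refine le_trans ?_ h3.ge
      calc θ * n ^ M * n ^ 2 = (θ * n ^ 2) * n ^ M := by ring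
        _ ≤ _ := by gcongr
    exact le_of_mul_le_mul_right h4 (by positivity)
  have hswap : ∑ f : Fin M → V, #{p : Fin M × Fin M | G.Adj (f p.1) (f p.2)} =
      ∑ p : Fin M × Fin M, #{f : Fin M → V | G.Adj (f p.1) (f p.2)} := by
    simp only [Finset.card_filter]
    exact Finset.sum_comm
  have hlow : ((M : ℝ) ^ 2 - M) * (θ * n ^ M) ≤
      ∑ p : Fin M × Fin M, (#{f : Fin M → V | G.Adj (f p.1) (f p.2)} : ℝ) := by
    have h1 : ((M : ℝ) ^ 2 - M) = #(univ : Finset (Fin M)).offDiag := by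
      rw [offDiag_card, Nat.cast_sub (Nat.le_mul_self _)]
      simp [sq]
    rw [h1, ← nsmul_eq_mul]
    refine (Finset.card_nsmul_le_sum _ _ _ fun p hp => hpair p (by simpa using hp)).trans ?_
    exact Finset.sum_le_sum_of_subset_of_nonneg (subset_univ _) fun _ _ _ => by positivity
  set good : (Fin M → V) → Prop := fun f => ¬ (G.comap f).CliqueFree (r + 1) with hgood
  have hup : ∀ f : Fin M → V, (#{p : Fin M × Fin M | G.Adj (f p.1) (f p.2)} : ℝ) ≤
      (1 - 1 / (r : ℝ)) * (M : ℝ) ^ 2 + if good f then (M : ℝ) ^ 2 else 0 := by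
    intro f
    by_cases hf : good f
    · have h1 := Finset.card_le_univ ({p : Fin M × Fin M | G.Adj (f p.1) (f p.2)} : Finset _)
      have h2 : (#{p : Fin M × Fin M | G.Adj (f p.1) (f p.2)} : ℝ) ≤ (M : ℝ) ^ 2 := by
        rw [sq]
        exact_mod_cast h1.trans (by simp)
      rw [if_pos hf]
      have : 0 ≤ (1 - 1 / (r : ℝ)) * (M : ℝ) ^ 2 := by positivity
      linarith
    -- A sample without a K_{r+1} obeys Turán's bound, so the excess must come from the good
    -- samples.
    · have h1 := two_mul_card_edgeFinset_le_of_cliqueFree (G.comap f) hr (not_not.1 hf)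
      rw [if_neg hf, add_zero]
      have h2 := two_mul_card_edgeFinset (G.comap f)
      have h3 : #{p : Fin M × Fin M | G.Adj (f p.1) (f p.2)} = 2 * #(G.comap f).edgeFinset := by
        rw [h2]; rfl
      rw [h3]
      simpa using h1
  have hmany : ε / 2 * n ^ M ≤ #{f : Fin M → V | good f} := by
    have h1 := Finset.sum_le_sum fun (f : Fin M → V) (_ : f ∈ univ) => hup f
    have h2 := congrArg (Nat.cast (R := ℝ)) hswap
    push_cast at h2
    rw [h2] at h1
    have h3 := hlow.trans h1
    rw [sum_add_distrib, ← Finset.sum_filter, sum_const, sum_const, Finset.card_univ,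
      Fintype.card_fun, Fintype.card_fin, nsmul_eq_mul, nsmul_eq_mul] at h3
    push_cast at h3
    rw [← hn] at h3
    have h4 : (M : ℝ) ^ 2 * (ε / 2 * n ^ M) ≤ (M : ℝ) ^ 2 * #{f : Fin M → V | good f} := by
      have h5 : (M : ℝ) ^ 2 * (ε / 2) ≤
          ((M : ℝ) ^ 2 - M) * θ - (1 - 1 / (r : ℝ)) * (M : ℝ) ^ 2 := by
        have h6 : θ ≤ 1 + ε := by rw [hθ]; linarith
        have h7 : ((M : ℝ) ^ 2 - M) * θ - (1 - 1 / (r : ℝ)) * (M : ℝ) ^ 2 =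
          M * (M * ε - θ) := by rw [hθ]; ring
        rw [h7, show (M : ℝ) ^ 2 * (ε / 2) = M * (M * ε / 2) by ring]
        gcongr
        linarith
      have h8 : 0 < n ^ M := by positivity
      nlinarith [mul_le_mul_of_nonneg_right h5 h8.le]
    exact le_of_mul_le_mul_left h4 (by positivity)
  set H : ℕ := #{h : Fin (r + 1) → V | ∀ i j, i ≠ j → G.Adj (h i) (h j)} with hH
  have hcover : #{f : Fin M → V | good f} * Fintype.card V ^ (r + 1) ≤
      Fintype.card (Fin (r + 1) ↪ Fin M) * (H * Fintype.card V ^ M) := by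
    have h1 : ({f : Fin M → V | good f} : Finset _) ⊆
        (univ : Finset (Fin (r + 1) ↪ Fin M)).biUnion fun φ =>
          {f : Fin M → V | ∀ i j, i ≠ j → G.Adj ((f ∘ φ) i) ((f ∘ φ) j)} := by
      intro f hf
      have hf' := (mem_filter.1 hf).2
      obtain ⟨ψ⟩ := (not_cliqueFree_iff_top_isContained _).1 hf'
      simp only [mem_biUnion, Finset.mem_filter, mem_univ, true_and]
      exact ⟨⟨ψ, ψ.injective⟩, fun i j hij =>
        ψ.toHom.map_adj (show (⊤ : SimpleGraph _).Adj i j from hij)⟩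
    calc _ ≤ (∑ φ : Fin (r + 1) ↪ Fin M,
          #{f : Fin M → V | ∀ i j, i ≠ j → G.Adj ((f ∘ φ) i) ((f ∘ φ) j)}) *
          Fintype.card V ^ (r + 1) := by
            gcongr
            exact (Finset.card_le_card h1).trans card_biUnion_le
      _ = ∑ φ : Fin (r + 1) ↪ Fin M, H * Fintype.card V ^ M := by
            rw [sum_mul]
            refine Finset.sum_congr rfl fun φ _ => ?_
            have := card_filter_comp (V := V) φ (fun h => ∀ i j, i ≠ j → G.Adj (h i) (h j))
            rw [Fintype.card_fin, Fintype.card_fin] at this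
            convert! this
      _ = _ := by simp
  have hcover' := (Nat.cast_le (α := ℝ)).2 hcover
  push_cast at hcover'
  rw [← hn] at hcover'
  set Φ : ℝ := (Fintype.card (Fin (r + 1) ↪ Fin M) : ℝ) with hΦ
  have hΦ0 : 0 ≤ Φ := by rw [hΦ]; positivity
  have hfin : ε / 2 * n ^ (r + 1) ≤ Φ * H := by
    have h1 : (ε / 2 * n ^ (r + 1)) * n ^ M ≤ (Φ * H) * n ^ M := by
      have h2 : 0 < n ^ (r + 1) := by positivity
      nlinarith [mul_le_mul_of_nonneg_right hmany h2.le]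
    exact le_of_mul_le_mul_right h1 (by positivity)
  rw [div_mul_eq_mul_div, div_le_iff₀ (by positivity)]
  have : (0 : ℝ) ≤ H := by positivity
  nlinarith

end RamseyTuran

/-! ### Dependent random choice and its iteration. -/

namespace RamseyTuran

open Finset

open Classical in
/-- Dependent random choice. -/
theorem exists_large_set_of_codegree {X Y : Type*} [Fintype X] [Fintype Y] [Nonempty Y]
    (F : X → Y → Prop) (δ δ' g : ℝ) (t : ℕ) (hδ : 0 ≤ δ) (hδ' : 0 ≤ δ')
    (hF : δ * Fintype.card X * Fintype.card Y ≤ #{p : X × Y | F p.1 p.2})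
    (hg : g < Fintype.card X * δ ^ (t + 1) - (Fintype.card X : ℝ) ^ 2 * δ' ^ (t + 1)) :
    ∃ U : Finset X, g < #U ∧ ∀ x ∈ U, ∀ y ∈ U,
      δ' * Fintype.card Y ≤ #{z : Y | F x z ∧ F y z} := by
  set n : ℝ := (Fintype.card X : ℝ) with hn
  set m : ℝ := (Fintype.card Y : ℝ) with hm
  have hm0 : 0 < m := by
    have := Fintype.card_pos (α := Y)
    rw [hm]; exact_mod_cast this
  have hn0 : 0 ≤ n := by rw [hn]; positivity
  set d : X → ℕ := fun x => #{z : Y | F x z} with hd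
  set bad : Finset (X × X) := {p | (#{z : Y | F p.1 z ∧ F p.2 z} : ℝ) < δ' * m} with hbad
  set U : (Fin (t + 1) → Y) → Finset X := fun τ => {x | ∀ i, F x (τ i)} with hU
  set W : (Fin (t + 1) → Y) → Finset (X × X) := fun τ => {p ∈ bad | p.1 ∈ U τ ∧ p.2 ∈ U τ} with hW
  have cnt : ∀ P : Y → Prop, #{τ : Fin (t + 1) → Y | ∀ i, P (τ i)} = #{z | P z} ^ (t + 1) := by
    intro P
    have := Fintype.card_piFinset_const ({z | P z} : Finset Y) (t + 1)
    rw [← this]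
    congr 1
    ext τ
    simp
  have hsumU : ∑ τ, #(U τ) = ∑ x, d x ^ (t + 1) := by
    simp only [hU, Finset.card_filter]
    rw [Finset.sum_comm]
    refine Finset.sum_congr rfl fun x _ => ?_
    rw [← Finset.card_filter, cnt]
  have hsumd : ∑ x, d x = #{p : X × Y | F p.1 p.2} := by
    simp only [hd, Finset.card_filter]
    rw [Fintype.sum_prod_type]
  have hlow : n * (δ * m) ^ (t + 1) ≤ ∑ τ, (#(U τ) : ℝ) := by
    have h1 := congrArg (Nat.cast (R := ℝ)) hsumU
    push_cast at h1
    rw [h1]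
    rcases hn0.eq_or_lt with h0 | h0
    · rw [← h0, zero_mul]; exact Finset.sum_nonneg fun _ _ => pow_nonneg (Nat.cast_nonneg _) _
    have h2 := pow_sum_div_card_le_sum_pow (s := (univ : Finset X)) (f := fun x => (d x : ℝ))
      (fun _ _ => Nat.cast_nonneg _) t
    refine le_trans ?_ h2
    rw [Finset.card_univ, ← hn, le_div_iff₀ (pow_pos h0 _), ← Nat.cast_sum, hsumd]
    calc n * (δ * m) ^ (t + 1) * n ^ t = (δ * n * m) ^ (t + 1) := by ring
      _ ≤ _ := by gcongr
  have hsumW : ∑ τ, (#(W τ) : ℝ) ≤ n ^ 2 * (δ' * m) ^ (t + 1) := by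
    have h1 : ∑ τ, #(W τ) = ∑ p ∈ bad, #{z : Y | F p.1 z ∧ F p.2 z} ^ (t + 1) := by
      simp only [hW, Finset.card_filter]
      rw [Finset.sum_comm]
      refine Finset.sum_congr rfl fun p _ => ?_
      rw [← Finset.card_filter, ← Finset.card_filter]
      refine Eq.trans ?_ ((cnt fun z => F p.1 z ∧ F p.2 z).trans (by congr!))
      congr 1
      ext τ
      simp [hU, forall_and]
    have h2 := congrArg (Nat.cast (R := ℝ)) h1
    push_cast at h2
    rw [h2]
    calc _ ≤ ∑ p ∈ bad, (δ' * m) ^ (t + 1) := by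
            refine Finset.sum_le_sum fun p hp => ?_
            have := (Finset.mem_filter.1 hp).2
            gcongr
      _ = #bad * (δ' * m) ^ (t + 1) := by simp
      _ ≤ _ := by
            gcongr
            rw [hn, sq]
            have := Finset.card_le_univ bad
            rw [Fintype.card_prod] at this
            exact_mod_cast this
  -- Average over `τ`: convexity bounds the common neighbourhoods from below, and a bad pair
  -- survives with probability at most δ'^(t+1).
  obtain ⟨τ, hτ⟩ : ∃ τ, g < (#(U τ) : ℝ) - #(W τ) := by
    by_contra! h
    have h1 := Finset.sum_le_sum fun τ (_ : τ ∈ (univ : Finset (Fin (t + 1) → Y))) => h τ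
    rw [sum_sub_distrib] at h1
    simp only [sum_const, nsmul_eq_mul, Finset.card_univ, Fintype.card_fun, Fintype.card_fin] at h1
    push_cast at h1
    rw [← hm] at h1
    have h2 : 0 < m ^ (t + 1) := by positivity
    have h3 := mul_lt_mul_of_pos_right hg h2
    rw [mul_pow] at hlow hsumW
    nlinarith
  -- Delete one vertex from each surviving bad pair.
  refine ⟨U τ \ (W τ).image Prod.fst, ?_, ?_⟩
  · have h1 : #(U τ) ≤ #(U τ \ (W τ).image Prod.fst) + #(W τ) := by
      have := Finset.le_card_sdiff ((W τ).image Prod.fst) (U τ)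
      have := Finset.card_image_le (s := W τ) (f := Prod.fst)
      omega
    have h2 := (Nat.cast_le (α := ℝ)).2 h1
    push_cast at h2
    linarith
  · intro x hx y hy
    by_contra! h
    have hx' := Finset.mem_sdiff.1 hx
    have hy' := Finset.mem_sdiff.1 hy
    refine hx'.2 (Finset.mem_image.2 ⟨(x, y), ?_, rfl⟩)
    simp only [hW, hbad, Finset.mem_filter, Finset.mem_univ, true_and]
    exact ⟨h, hx'.1, hy'.1⟩

open Classical in
/-- Iterated dependent random choice: a dense family of tuples contains a complete system of
doubled tuples. -/
theorem exists_doubled_tuple {V : Type*} [Fintype V] [Nonempty V] (r : V → V → Prop) (g : ℝ)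
    (δ : ℕ → ℝ) (t : ℕ → ℕ) (hδ : ∀ k, 0 < δ k) (q : ℕ)
    (h0 : g < δ 0 * Fintype.card V)
    (hstep : ∀ k < q, g < Fintype.card V * δ (k + 1) ^ (t k + 1) -
      (Fintype.card V : ℝ) ^ 2 * δ k ^ (t k + 1))
    (F : (Fin (q + 1) → V) → Prop) (P : Fin (q + 1) → V → Prop)
    (hF : δ q * (Fintype.card V : ℝ) ^ (q + 1) ≤ #{f | F f})
    (hFP : ∀ f, F f → ∀ i, P i (f i))
    (hP : ∀ i, ∀ S : Finset V, (∀ x ∈ S, P i x) → g < #S → ∃ x ∈ S, ∃ y ∈ S, r x y) :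
    ∃ x y : Fin (q + 1) → V, (∀ i, r (x i) (y i)) ∧
      ∀ b : Fin (q + 1) → Bool, F fun i => if b i then x i else y i := by
  induction q with
  | zero =>
    obtain ⟨x, hx, y, hy, hxy⟩ := hP 0 (({f | F f} : Finset _).image fun f => f 0) (by
      intro x hx
      obtain ⟨f, hf, rfl⟩ := Finset.mem_image.1 hx
      exact hFP f (Finset.mem_filter.1 hf).2 0) (by
      rw [Finset.card_image_of_injective]
      · simpa using h0.trans_le (by simpa using hF)
      · intro f f' h
        funext i
        obtain rfl : i = 0 := Subsingleton.elim (α := Fin 1) i 0; exact h)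
    simp only [Finset.mem_image, Finset.mem_filter, Finset.mem_univ, true_and] at hx hy
    obtain ⟨f, hf, rfl⟩ := hx
    obtain ⟨f', hf', rfl⟩ := hy
    refine ⟨f, f', fun i => by
      obtain rfl : i = 0 := Subsingleton.elim (α := Fin 1) i 0; exact hxy, fun b => ?_⟩
    cases hb : b 0
    · convert hf' using 2 with i
      obtain rfl : i = 0 := Subsingleton.elim (α := Fin 1) i 0; simp [hb]
    · convert hf using 2 with i
      obtain rfl : i = 0 := Subsingleton.elim (α := Fin 1) i 0; simp [hb]
  | succ q ih =>
    have hcard : #{p : V × (Fin (q + 1) → V) | F (Fin.cons p.1 p.2)} = #{f | F f} := by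
      refine Finset.card_equiv (Fin.consEquiv fun _ : Fin (q + 2) => V) fun p => ?_
      simp [Fin.consEquiv]
    obtain ⟨U, hU, hUd⟩ := exists_large_set_of_codegree
      (fun (x : V) (z : Fin (q + 1) → V) => F (Fin.cons x z)) (δ (q + 1)) (δ q) g (t q)
      (hδ _).le (hδ _).le (by
        rw [hcard]
        refine le_trans (le_of_eq ?_) hF
        simp only [Fintype.card_fun, Fintype.card_fin]
        push_cast
        ring) (hstep q (by omega))
    obtain ⟨x, hx, y, hy, hxy⟩ := hP 0 U (by
      intro x hx
      -- The diagonal pair shows that `x` itself extends to a tuple of the family.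
      have h1 := hUd x hx x hx
      have h2 : (0 : ℝ) < #{z : Fin (q + 1) → V | F (Fin.cons x z) ∧ F (Fin.cons x z)} :=
        lt_of_lt_of_le (mul_pos (hδ q) (by exact_mod_cast Fintype.card_pos)) h1
      obtain ⟨z, hz⟩ := Finset.card_pos.1 (Nat.cast_pos.1 h2)
      simpa using hFP _ (Finset.mem_filter.1 hz).2.1 0) hU
    -- Continue with the tails compatible with both `x` and `y`, a family of density at least `δ q`.
    obtain ⟨x', y', hr, hb⟩ := ih (fun k hk => hstep k (by omega))
      (fun z => F (Fin.cons x z) ∧ F (Fin.cons y z)) (fun i => P i.succ) (by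
        have := hUd x hx y hy
        simp only [Fintype.card_fun, Fintype.card_fin] at this
        push_cast at this
        convert! this)
      (fun f hf i => by simpa using hFP _ hf.1 i.succ) (fun i => hP i.succ)
    refine ⟨Fin.cons x x', Fin.cons y y', ?_, ?_⟩
    · intro i
      refine Fin.cases ?_ (fun i => ?_) i
      · simpa using hxy
      · simpa using hr i
    · intro b
      have := hb (fun i => b i.succ)
      cases h : b 0
      · convert this.2 using 1
        funext i
        refine Fin.cases ?_ (fun i => ?_) i <;> simp [h]
      · convert this.1 using 1
        funext i
        refine Fin.cases ?_ (fun i => ?_) i <;> simp [h]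

/-- The densities and exponents for which `exists_doubled_tuple` applies to `n` vertices with
independence number at most `n / exp (K (log n) ^ (1 - 1 / s))`. -/
theorem eventually_exists_densities {c : ℝ} (hc : 0 < c) (s : ℕ) (hs : 1 ≤ s) :
    ∃ K : ℝ, ∀ᶠ n : ℕ in atTop, ∀ q < s, ∃ (δ : ℕ → ℝ) (t : ℕ → ℕ), (∀ k, 0 < δ k) ∧
      δ q ≤ c ∧ n / Real.exp (K * Real.log n ^ (1 - 1 / (s : ℝ))) < δ 0 * n ∧
      ∀ k < q, n / Real.exp (K * Real.log n ^ (1 - 1 / (s : ℝ))) <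
        n * δ (k + 1) ^ (t k + 1) - (n : ℝ) ^ 2 * δ k ^ (t k + 1) := by
  -- exp(-D) ≤ c bounds the last density; D ≥ 2 absorbs the factor n² in the bad-pair term.
  set D : ℝ := max 2 (-Real.log c) with hD
  have hD2 : 2 ≤ D := le_max_left _ _
  have hDc : Real.exp (-D) ≤ c := by
    rw [← Real.exp_log hc, Real.exp_le_exp]
    have := le_max_right 2 (-Real.log c)
    linarith
  refine ⟨4 * D, ?_⟩
  have hs0 : (0 : ℝ) < s := by exact_mod_cast hs
  have hlog : Tendsto (fun n : ℕ => Real.log n) atTop atTop :=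
    Real.tendsto_log_atTop.comp tendsto_natCast_atTop_atTop
  have hlam : ∀ᶠ n : ℕ in atTop, 2 * D + 1 ≤ Real.log n ^ (1 / (s : ℝ)) :=
    ((tendsto_rpow_atTop (by positivity)).comp hlog).eventually_ge_atTop _
  filter_upwards [hlam, hlog.eventually_ge_atTop 0, eventually_ge_atTop 1] with n hn hL hn1
  intro q hq
  set L : ℝ := Real.log n with hLdef
  set l : ℝ := L ^ (1 / (s : ℝ)) with hl
  have hls : l ^ s = L := by
    rw [hl, ← Real.rpow_natCast, ← Real.rpow_mul hL]
    field_simp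
    simp
  have hmu : L ^ (1 - 1 / (s : ℝ)) = l ^ (s - 1) := by
    rw [hl, ← Real.rpow_natCast, ← Real.rpow_mul hL, Nat.cast_sub hs]
    congr 1
    field_simp
    simp
  have hl1 : 1 ≤ l := by linarith
  have hnexp : (n : ℝ) = Real.exp L := by
    rw [hLdef, Real.exp_log (by exact_mod_cast hn1)]
  have hlpow : l ^ s = l ^ (s - 1) * l := by
    rw [← pow_succ, Nat.sub_add_cancel hs]
  set μ : ℝ := l ^ (s - 1) with hμ
  have hμ1 : 1 ≤ μ := one_le_pow₀ hl1
  rw [hmu, hnexp, ← Real.exp_sub]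
  -- With l = (log n)^(1/s), the exponents satisfy t_k l^(q-k) ≈ log n, which kills the bad pairs,
  -- and t_k l^(q-k-1) ≈ l^(s-1), which keeps the loss within the allowed exponent.
  refine ⟨fun k => Real.exp (-(D * l ^ (q - k))), fun k => ⌊l ^ (s - (q - k))⌋₊,
    fun k => Real.exp_pos _, ?_, ?_, ?_⟩
  · simpa using hDc
  · rw [← Real.exp_add, Real.exp_lt_exp, Nat.sub_zero]
    have : l ^ q ≤ μ := pow_le_pow_right₀ hl1 (by omega)
    nlinarith
  · intro k hk
    set T : ℕ := ⌊l ^ (s - (q - k))⌋₊ + 1 with hT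
    have hpow1 : 1 ≤ l ^ (s - (q - k)) := one_le_pow₀ hl1
    have hT1 : l ^ (s - (q - k)) ≤ T := by
      rw [hT]; push_cast; exact (Nat.lt_floor_add_one _).le
    have hT2 : (T : ℝ) ≤ 2 * l ^ (s - (q - k)) := by
      have := Nat.floor_le (zero_le_one.trans hpow1)
      rw [hT]; push_cast; linarith
    have e1 : (T : ℝ) * l ^ (q - (k + 1)) ≤ 2 * μ := by
      calc (T : ℝ) * l ^ (q - (k + 1)) ≤ 2 * l ^ (s - (q - k)) * l ^ (q - (k + 1)) := by gcongr
        _ = 2 * μ := by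
          rw [mul_assoc, ← pow_add, hμ]
          congr 2
          omega
    have e2 : L ≤ T * l ^ (q - k) := by
      calc L = l ^ (s - (q - k)) * l ^ (q - k) := by
            rw [← pow_add, ← hls]
            congr 1
            omega
        _ ≤ _ := by gcongr
    have f1 : Real.exp (L - 2 * D * μ) ≤
        Real.exp L * Real.exp (-(D * l ^ (q - (k + 1)))) ^ T := by
      rw [← Real.exp_nat_mul, ← Real.exp_add, Real.exp_le_exp]
      nlinarith
    have f2 : Real.exp L ^ 2 * Real.exp (-(D * l ^ (q - k))) ^ T ≤ 1 := by
      rw [← Real.exp_nat_mul, ← Real.exp_nat_mul, ← Real.exp_add, Real.exp_le_one_iff]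
      push_cast
      nlinarith
    have f3 : Real.exp 1 ≤ Real.exp (L - 2 * D * μ) := by
      rw [Real.exp_le_exp]
      nlinarith
    have f4 : Real.exp (L - 4 * D * μ) * Real.exp 1 ≤ Real.exp (L - 2 * D * μ) := by
      rw [← Real.exp_add, Real.exp_le_exp]
      nlinarith
    have f5 := Real.exp_one_gt_d9
    have f6 := Real.exp_pos (L - 4 * D * μ)
    nlinarith

end RamseyTuran

/-! ### Upper bound. -/

namespace RamseyTuran

open SimpleGraph Finset

theorem not_cliqueFree_of_pairwise_adj {V W : Type*} [Fintype W] (G : SimpleGraph V) (f : W → V)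
    (hf : ∀ a b, a ≠ b → G.Adj (f a) (f b)) {k : ℕ} (hk : k ≤ Fintype.card W) :
    ¬ G.CliqueFree k := by
  obtain ⟨e⟩ : Nonempty (Fin k ↪ W) :=
    Function.Embedding.nonempty_of_card_le (by rwa [Fintype.card_fin])
  refine (show completeGraph (Fin k) ⊑ G from
    ⟨⟨⟨f ∘ e, fun {a b} hab => hf _ _ fun h => hab (e.injective h)⟩, ?_⟩⟩).not_cliqueFree
  intro a b hab
  by_contra hne
  exact (hf _ _ fun h => hne (e.injective h)).ne hab

/-- A set larger than the independence number inside a blue neighbourhood spans a red edge. -/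
theorem exists_adj_of_indepNum_lt {V : Type*} [Fintype V] (G B R : SimpleGraph V)
    (hR : ∀ x y, G.Adj x y → ¬ B.Adj x y → R.Adj x y) (hB : B.CliqueFree 3)
    (w : V) (S : Finset V) (hSw : ∀ x ∈ S, B.Adj x w) (hS : G.indepNum < #S) :
    ∃ x ∈ S, ∃ y ∈ S, R.Adj x y := by
  classical
  have : ¬ G.IsIndepSet (S : Set V) := fun h => absurd h.card_le_indepNum (by omega)
  simp only [IsIndepSet, Set.Pairwise, not_forall, not_not] at this
  obtain ⟨x, hx, y, hy, -, hxy⟩ := this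
  refine ⟨x, hx, y, hy, hR x y hxy fun hb => ?_⟩
  exact hB {x, y, w} (is3Clique_triple_iff.2 ⟨hb, hSw x hx, hSw y hy⟩)

open Classical in
theorem exists_dense_pattern {N : ℕ} {V : Type*} [Fintype V] [Nonempty V] (G B : SimpleGraph V)
    {c : ℝ} (hc : c * (Fintype.card V : ℝ) ^ N ≤
      #{h : Fin N → V | ∀ i j, i ≠ j → G.Adj (h i) (h j)}) :
    ∃ P : SimpleGraph (Fin N), c / Fintype.card (SimpleGraph (Fin N)) *
      (Fintype.card V : ℝ) ^ N ≤
        #{h : Fin N → V | (∀ i j, i ≠ j → G.Adj (h i) (h j)) ∧ B.comap h = P} := by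
  by_contra! h
  have h1 := Finset.sum_lt_sum_of_nonempty (univ_nonempty (α := SimpleGraph (Fin N)))
    fun P _ => h P
  have h2 := Finset.card_eq_sum_card_fiberwise (f := fun h : Fin N → V => B.comap h)
    (s := {h : Fin N → V | ∀ i j, i ≠ j → G.Adj (h i) (h j)}) (t := univ) (fun _ _ => by simp)
  simp only [Finset.filter_filter] at h2
  rw [h2] at hc
  rw [← Nat.cast_sum] at h1
  rw [sum_const, nsmul_eq_mul, Finset.card_univ, ← mul_assoc, mul_div_cancel₀] at h1
  · exact absurd hc (not_le.2 h1)
  · exact_mod_cast Fintype.card_ne_zero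

/-- Two-coloured graphs with small independence number, no blue triangle and no large red clique
are sparse. -/
theorem eventually_card_adj_lt {s : ℕ} (hs : 2 ≤ s) {e : ℕ} (he : e ≤ 1) {ε : ℝ} (hε : 0 < ε) :
    ∃ K : ℝ, ∀ᶠ n : ℕ in atTop, ∀ (G B R : SimpleGraph (Fin n)),
      (∀ x y, G.Adj x y → ¬ B.Adj x y → R.Adj x y) → B.CliqueFree 3 →
      R.CliqueFree (2 * s - 1 + e) →
      (G.indepNum : ℝ) ≤ n / Real.exp (K * Real.log n ^ (1 - 1 / (s : ℝ))) →
      (2 * G.edgeSet.ncard : ℝ) <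
        (1 - 1 / ((ramseyNumber 3 s + e - 1 : ℕ) : ℝ) + ε) * (n : ℝ) ^ 2 := by
  classical
  obtain ⟨r, hr⟩ : ∃ r, r = ramseyNumber 3 s + e - 1 := ⟨_, rfl⟩
  have hR3 := three_le_ramseyNumber hs
  rw [← hr]
  obtain ⟨c, hc, hsup⟩ := exists_le_card_hom_top (r := r) (by omega) hε
  set c' : ℝ := c / Fintype.card (SimpleGraph (Fin (r + 1))) with hc'
  have hc'0 : 0 < c' := div_pos hc (by exact_mod_cast Fintype.card_pos)
  obtain ⟨K, hK⟩ := eventually_exists_densities hc'0 s (by omega)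
  refine ⟨K, ?_⟩
  filter_upwards [hK, eventually_ge_atTop 1] with n hn hn1
  intro G B R hRed hB hRf hα
  by_contra! hedge
  have : Nonempty (Fin n) := ⟨⟨0, hn1⟩⟩
  have hcount := hsup (Fin n) G (by
    rw [Fintype.card_fin]
    refine hedge.trans (le_of_eq ?_)
    have h1 := two_mul_card_edgeFinset G
    rw [← Set.ncard_coe_finset, coe_edgeFinset] at h1
    exact_mod_cast h1)
  obtain ⟨P, hP⟩ := exists_dense_pattern G B hcount
  rw [← hc', Fintype.card_fin] at hP
  set S : (Fin (r + 1) → Fin n) → Prop :=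
    fun h => (∀ i j, i ≠ j → G.Adj (h i) (h j)) ∧ B.comap h = P with hS
  have hSne : ∃ h, S h := by
    have h1 : (0 : ℝ) < #{h | S h} := lt_of_lt_of_le (by positivity) hP
    obtain ⟨h, hh⟩ := Finset.card_pos.1 (Nat.cast_pos.1 h1)
    exact ⟨h, (Finset.mem_filter.1 hh).2⟩
  have hP3 : P.CliqueFree 3 := by
    obtain ⟨h, hh1, rfl⟩ := hSne
    intro T hT
    obtain ⟨a, b, d, hab, had, hbd, -⟩ := is3Clique_iff.1 hT
    exact hB {h a, h b, h d} (is3Clique_triple_iff.2 ⟨hab, had, hbd⟩)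
  obtain ⟨Q, A, hQA, hind, hpart, hQs, hweight⟩ := exists_weighted_indep P hP3 s e (by omega) he
    (by rw [Fintype.card_fin]; omega)
  have hred : ∀ h, S h → ∀ u ∈ Q ∪ A, ∀ v ∈ Q ∪ A, u ≠ v → R.Adj (h u) (h v) := by
    intro h hh u hu v hv huv
    refine hRed _ _ (hh.1 u v huv) fun hb => hind u hu v hv ?_
    rw [← hh.2]
    exact hb
  rcases Nat.eq_zero_or_pos #Q with hQ0 | hQ0
  · obtain ⟨h, hh⟩ := hSne
    refine not_cliqueFree_of_pairwise_adj R (fun a : A => h a) ?_ (k := 2 * s - 1 + e)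
      (by rw [Fintype.card_coe]; omega) hRf
    intro a b hab
    exact hred h hh a (mem_union_right _ a.2) b (mem_union_right _ b.2)
      fun h => hab (Subtype.ext h)
  obtain ⟨q, hq⟩ : ∃ q, #Q = q + 1 := ⟨#Q - 1, by omega⟩
  let φ : Fin (q + 1) ↪ Fin (r + 1) := (Q.equivFinOfCardEq hq).symm.toEmbedding.trans
    (Function.Embedding.subtype _)
  have hφ : ∀ i, φ i ∈ Q := fun i => Subtype.coe_prop _
  have hφA : ∀ v, v ∉ Q → ¬ ∃ i, φ i = v := by
    rintro v hv ⟨i, rfl⟩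
    exact hv (hφ i)
  obtain ⟨z, hz⟩ := exists_le_card_filter_extend φ S c' (by
    rw [Fintype.card_fin, Fintype.card_fin]
    convert! hP)
  obtain ⟨δ, t, hδ, hδq, hδ0, hstep⟩ := hn q (by omega)
  -- These blue neighbours lie outside `Q`, so their images are already fixed by `z`.
  choose y hy using fun i => hpart (φ i) (hφ i)
  have hyQ : ∀ i, y i ∉ Q := fun i hi =>
    hind (φ i) (mem_union_left _ (hφ i)) (y i) (mem_union_left _ hi) (hy i)
  obtain ⟨x, x', hxx, hsel⟩ := exists_doubled_tuple R.Adj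
    (n / Real.exp (K * Real.log n ^ (1 - 1 / (s : ℝ)))) δ t hδ q
    (by simpa using hδ0) (by simpa using hstep) (fun x => S (Function.extend φ x z))
    (fun i v => B.Adj v (z (y i))) (by
      refine le_trans ?_ (hz.trans (le_of_eq ?_))
      · rw [Fintype.card_fin (q + 1)]
        gcongr
      · congr!) (by
      rintro f ⟨-, hf⟩ i
      have := hy i
      rw [← hf] at this
      simpa [φ.injective.extend_apply, Function.extend_apply' _ _ _ (hφA _ (hyQ i))] using this)
    (fun i T hT hcard => exists_adj_of_indepNum_lt G B R hRed hB (z (y i)) T hT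
      (by exact_mod_cast hα.trans_lt hcard))
  set sel : (Fin (q + 1) → Bool) → Fin (r + 1) → Fin n :=
    fun b => Function.extend φ (fun i => if b i then x i else x' i) z with hsel'
  have hsel2 : ∀ b, S (sel b) := hsel
  have hselφ : ∀ b i, sel b (φ i) = if b i then x i else x' i := fun b i => by
    simp only [hsel', φ.injective.extend_apply]
  have hselA : ∀ b, ∀ a ∈ A, sel b a = z a := fun b a ha =>
    Function.extend_apply' _ _ _ (hφA a fun hq => disjoint_left.1 hQA hq ha)
  let f : (Fin (q + 1) × Bool) ⊕ A → Fin n :=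
    Sum.elim (fun p => if p.2 then x p.1 else x' p.1) (fun a => z a)
  refine not_cliqueFree_of_pairwise_adj R f ?_ (k := 2 * s - 1 + e)
    (by simp only [Fintype.card_sum, Fintype.card_prod, Fintype.card_fin, Fintype.card_bool,
          Fintype.card_coe]; omega) hRf
  have hmix : ∀ (i : Fin (q + 1)) (b : Bool) (a : A), R.Adj (f (.inl (i, b))) (f (.inr a)) := by
    intro i b a
    have h1 := hred _ (hsel2 fun _ => b) (φ i) (mem_union_left _ (hφ i)) a
      (mem_union_right _ a.2) (fun h => disjoint_left.1 hQA (hφ i) (h ▸ a.2))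
    have h2 := hselφ (fun _ => b) i
    have h3 := hselA (fun _ => b) a a.2
    rw [h2, h3] at h1
    exact h1
  rintro (⟨i, b⟩ | a) (⟨j, b'⟩ | a') hne
  · by_cases hij : i = j
    · subst hij
      have := hxx i
      cases b <;> cases b' <;> simp [f] at hne ⊢
      · exact this.symm
      · exact this
    -- Vertices at different positions occur together in a mixed selection, which still has the blue
    -- pattern `P`.
    · have h1 := hred _ (hsel2 fun k => if k = i then b else b') (φ i) (mem_union_left _ (hφ i))
        (φ j) (mem_union_left _ (hφ j)) (fun h => hij (φ.injective h))
      have h2 := hselφ (fun k => if k = i then b else b') i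
      have h3 := hselφ (fun k => if k = i then b else b') j
      rw [h2, h3, if_pos rfl, if_neg (Ne.symm hij)] at h1
      exact h1
  · exact hmix i b a'
  · exact (hmix j b' a).symm
  · have h1 := hred _ (hsel2 fun _ => true) a (mem_union_right _ a.2) a'
      (mem_union_right _ a'.2) (fun h => hne (congrArg Sum.inr (Subtype.ext h)))
    have h2 := hselA (fun _ => true) a a.2
    have h3 := hselA (fun _ => true) a' a'.2
    rw [h2, h3] at h1
    exact h1

/-- The two graphs may overlap or leave `G`, since restricting to edges of `G` and giving blue
priority only removes edges. -/
theorem multicolourFree_cliquePair_iff {a b : ℕ} {V : Type} (G : SimpleGraph V) :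
    MulticolourFree (cliquePair a b) G ↔ ∃ B R : SimpleGraph V,
      (∀ x y, G.Adj x y → ¬ B.Adj x y → R.Adj x y) ∧ B.CliqueFree a ∧ R.CliqueFree b := by
  classical
  have key : ∀ (k : ℕ) (H : SimpleGraph V),
      (completeGraph (Fin k)).Free H ↔ H.CliqueFree k := fun k H => by
    rw [← not_iff_not, not_cliqueFree_iff_top_isContained, not_free]
  constructor
  · rintro ⟨φ, hφ⟩
    refine ⟨φ.labelGraph 0, φ.labelGraph 1, ?_, (key a _).1 (hφ 0), (key b _).1 (hφ 1)⟩
    intro x y hxy h0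
    rw [EdgeLabeling.labelGraph_adj] at h0 ⊢
    refine ⟨hxy, ?_⟩
    by_contra h1
    exact h0 ⟨hxy, by omega⟩
  · rintro ⟨B, R, hBR, hB, hR⟩
    refine ⟨fun e => if e.1 ∈ B.edgeSet then 0 else 1, fun i => ?_⟩
    fin_cases i
    · refine (key a _).2 (hB.anti ?_)
      intro x y hxy
      obtain ⟨h, h'⟩ := (EdgeLabeling.labelGraph_adj _ _).1 hxy
      by_contra hb
      simp [hb] at h'
    · refine (key b _).2 (hR.anti ?_)
      intro x y hxy
      obtain ⟨h, h'⟩ := (EdgeLabeling.labelGraph_adj _ _).1 hxy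
      refine hBR x y h fun hb => ?_
      simp [hb] at h'

/-! ### A triangle-free graph on the Boolean cube. -/

theorem hammingDist_cons {k : ℕ} (a b : Bool) (x y : Fin k → Bool) :
    hammingDist (Fin.cons a x : Fin (k + 1) → Bool) (Fin.cons b y) =
      (if a = b then 0 else 1) + hammingDist x y := by
  simp only [hammingDist, Finset.card_filter, Fin.sum_univ_succ, Fin.cons_zero, Fin.cons_succ]
  congr 1
  cases a <;> cases b <;> simp

/-- An isodiametric inequality for a pair of subsets of the Boolean cube. -/
theorem card_mul_card_le_of_hammingDist_le {k : ℕ} (D : ℕ) (A B : Finset (Fin k → Bool))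
    (h : ∀ a ∈ A, ∀ b ∈ B, hammingDist a b ≤ D) :
    (#A : ℝ) * #B ≤ (9 / 4) ^ k * 2 ^ D := by
  induction k generalizing D with
  | zero =>
    have hA : #A ≤ 1 := by simpa using Finset.card_le_univ A
    have hB : #B ≤ 1 := by simpa using Finset.card_le_univ B
    have h1 : (#A : ℝ) * #B ≤ 1 := by exact_mod_cast Nat.mul_le_mul hA hB
    have h2 : (1 : ℝ) ≤ 2 ^ D := one_le_pow₀ (by norm_num)
    simpa using h1.trans h2
  | succ k ih =>
    let sec (S : Finset (Fin (k + 1) → Bool)) (c : Bool) : Finset (Fin k → Bool) :=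
      {x | (Fin.cons c x : Fin (k + 1) → Bool) ∈ S}
    have hsec : ∀ S : Finset (Fin (k + 1) → Bool), (#S : ℝ) = #(sec S true) + #(sec S false) := by
      intro S
      have h1 : #{p : Bool × (Fin k → Bool) | (Fin.cons p.1 p.2 : Fin (k + 1) → Bool) ∈ S} = #S :=
        Finset.card_equiv (Fin.consEquiv fun _ : Fin (k + 1) => Bool) fun p => by
          simp [Fin.consEquiv]
      rw [← h1]
      simp only [sec, Finset.card_filter]
      rw [Fintype.sum_prod_type]
      simp
    set E : ℝ := (9 / 4) ^ k * 2 ^ D with hE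
    have hE0 : 0 < E := by positivity
    have hsame : ∀ c, (#(sec A c) : ℝ) * #(sec B c) ≤ E := fun c => ih D _ _ fun a ha b hb => by
      have := h _ (Finset.mem_filter.1 ha).2 _ (Finset.mem_filter.1 hb).2
      rw [hammingDist_cons] at this
      simpa using this
    have hdiff : ∀ c d, c ≠ d → 2 * ((#(sec A c) : ℝ) * #(sec B d)) ≤ E := fun c d hcd => by
      have hlt : ∀ a ∈ sec A c, ∀ b ∈ sec B d, 1 + hammingDist a b ≤ D := fun a ha b hb => by
        have := h _ (Finset.mem_filter.1 ha).2 _ (Finset.mem_filter.1 hb).2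
        rw [hammingDist_cons, if_neg hcd] at this
        exact this
      rcases D with _ | D
      · rcases (sec A c).eq_empty_or_nonempty with h0 | ⟨a, ha⟩
        · simp [h0, hE0.le]
        · rcases (sec B d).eq_empty_or_nonempty with h0 | ⟨b, hb⟩
          · simp [h0, hE0.le]
          · have := hlt a ha b hb; omega
      · have := ih D _ _ fun a ha b hb => by have := hlt a ha b hb; omega
        rw [hE, pow_succ]
        linarith
    have p1 := hsame true
    have p2 := hsame false
    have p3 := hdiff true false (by simp)
    have p4 := hdiff false true (by simp)
    rw [hsec A, hsec B, show ((9 : ℝ) / 4) ^ (k + 1) * 2 ^ D = 9 / 4 * E by rw [hE]; ring]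
    have n1 : (0 : ℝ) ≤ #(sec A true) * #(sec B false) := by positivity
    have n2 : (0 : ℝ) ≤ #(sec A false) * #(sec B true) := by positivity
    generalize (#(sec A true) : ℝ) = a1 at *
    generalize (#(sec A false) : ℝ) = a0 at *
    generalize (#(sec B true) : ℝ) = b1 at *
    generalize (#(sec B false) : ℝ) = b0 at *
    -- The diagonal products p, q ≤ E have pq ≤ E²/4, so (E-p)(E-q) ≥ 0 gives p + q ≤ 5E/4. The
    -- off-diagonal products add at most E, whence 9/4.
    have h1 : (a1 * b1) * (a0 * b0) ≤ E / 2 * (E / 2) := by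
      rw [show (a1 * b1) * (a0 * b0) = (a1 * b0) * (a0 * b1) by ring]
      exact mul_le_mul (by linarith) (by linarith) n2 (by linarith)
    have h2 := mul_nonneg (sub_nonneg.2 p1) (sub_nonneg.2 p2)
    have h3 : (a1 * b1 + a0 * b0) * E ≤ 5 / 4 * E * E := by linarith
    have h4 := le_of_mul_le_mul_right h3 hE0
    linarith

/-- The graph on the Boolean cube of dimension `3 m` joining points at distance more than `2 m`. -/
def farGraph (m : ℕ) : SimpleGraph (Fin (3 * m) → Bool) where
  Adj x y := 2 * m < hammingDist x y
  symm := ⟨fun x y h => by rwa [hammingDist_comm]⟩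
  loopless := ⟨fun x h => by simp at h⟩

/-- On each coordinate three bits disagree in at most two of the three pairs, so the three distances
sum to at most 6m. -/
theorem farGraph_cliqueFree (m : ℕ) : (farGraph m).CliqueFree 3 := by
  intro T hT
  obtain ⟨a, b, c, hab, hac, hbc, -⟩ := is3Clique_iff.1 hT
  have h : hammingDist a b + hammingDist a c + hammingDist b c ≤ 2 * (3 * m) := by
    simp only [hammingDist, Finset.card_filter, ← Finset.sum_add_distrib]
    calc _ ≤ ∑ i : Fin (3 * m), 2 := Finset.sum_le_sum fun i _ => by
            cases a i <;> cases b i <;> cases c i <;> simp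
      _ = _ := by simp [mul_comm]
  simp only [farGraph] at hab hac hbc
  omega

/-- (9/4)^(3m) 2^(2m) = (27/4)^(2m); the gain is 27/4 < 8. -/
theorem card_le_of_isIndepSet_farGraph {m : ℕ} (S : Finset (Fin (3 * m) → Bool))
    (hS : ∀ x ∈ S, ∀ y ∈ S, ¬ (farGraph m).Adj x y) : (#S : ℝ) ≤ (27 / 4) ^ m := by
  have h := card_mul_card_le_of_hammingDist_le (2 * m) S S fun a ha b hb => not_lt.1 (hS a ha b hb)
  rw [pow_mul, pow_mul, ← mul_pow, ← sq] at h
  refine le_of_sq_le_sq (h.trans (le_of_eq ?_)) (by positivity)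
  rw [← pow_mul, mul_comm m 2, pow_mul]
  norm_num

/-! ### Lower bound construction. -/

/-- Blowing up a pattern without blue triangles and red `K_s`, with `e` additional parts. -/
theorem exists_colouring_of_pattern {M e s : ℕ} (B₀ : SimpleGraph (Fin M)) (hB₀ : B₀.CliqueFree 3)
    (hR₀ : B₀ᶜ.CliqueFree s) {V : Type} (part : V → Fin M ⊕ Fin e) (C : SimpleGraph V)
    (hC : C.CliqueFree 3) (G : SimpleGraph V)
    (hG : ∀ x y, G.Adj x y → part x = part y → C.Adj x y) :
    MulticolourFree (cliquePair 3 (2 * s - 1 + e)) G := by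
  classical
  have hs : 1 ≤ s := by
    by_contra! h
    obtain rfl : s = 0 := by omega
    exact not_cliqueFree_zero hR₀
  rw [multicolourFree_cliquePair_iff]
  set H : SimpleGraph (Fin M ⊕ Fin e) := B₀ ⊕g ⊥ with hH
  let Bl : SimpleGraph V :=
    { Adj := fun v w => H.Adj (part v) (part w) ∨
        (part v = part w ∧ (part v).isRight ∧ C.Adj v w)
      symm := ⟨by
        rintro v w (h | ⟨h, h', hc⟩)
        exacts [Or.inl h.symm, Or.inr ⟨h.symm, h ▸ h', hc.symm⟩]⟩
      loopless := ⟨by rintro v (h | h); exacts [h.ne rfl, h.2.2.ne rfl]⟩ }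
  let Rd : SimpleGraph V :=
    { Adj := fun v w => (part v ≠ part w ∧ ¬ H.Adj (part v) (part w)) ∨
        (part v = part w ∧ (part v).isLeft ∧ C.Adj v w)
      symm := ⟨by
        rintro v w (h | ⟨h, h', hc⟩)
        exacts [Or.inl ⟨h.1.symm, fun h' => h.2 h'.symm⟩, Or.inr ⟨h.symm, h ▸ h', hc.symm⟩]⟩
      loopless := ⟨by rintro v (h | h); exacts [h.1 rfl, h.2.2.ne rfl]⟩ }
  have hright : ∀ p q, H.Adj p q → ¬ p.isRight := by
    rintro (p | p) (q | q) h <;> simp [hH] at h ⊢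
  have hCtri : ∀ a b c, C.Adj a b → C.Adj a c → ¬ C.Adj b c := fun a b c hab hac hbc =>
    hC {a, b, c} (is3Clique_triple_iff.2 ⟨hab, hac, hbc⟩)
  refine ⟨Bl, Rd, ?_, ?_, ?_⟩
  · intro x y hxy hb
    simp only [Bl, not_or, not_and] at hb
    by_cases hp : part x = part y
    · have hc := hG x y hxy hp
      refine Or.inr ⟨hp, ?_, hc⟩
      by_contra hl
      exact hb.2 hp (by simpa using hl) hc
    · exact Or.inl ⟨hp, hb.1⟩
  · intro T hT
    obtain ⟨a, b, c, hab, hac, hbc, -⟩ := is3Clique_iff.1 hT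
    rcases hab with hab | ⟨hab, hr, hab'⟩
    · rcases hac with hac | ⟨hac, hr, -⟩
      · rcases hbc with hbc | ⟨-, hr, -⟩
        · revert hab hac hbc
          generalize part a = a
          generalize part b = b
          generalize part c = c
          rcases a with a | a <;> rcases b with b | b <;> rcases c with c | c <;> simp [hH]
          exact fun h1 h2 h3 => hB₀ {a, b, c} (is3Clique_triple_iff.2 ⟨h1, h2, h3⟩)
        · exact hright _ _ hab.symm hr
      · exact hright _ _ hab hr
    · rcases hac with hac | ⟨-, -, hac'⟩
      · exact hright _ _ hac hr
      · rcases hbc with hbc | ⟨-, -, hbc'⟩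
        · exact hright _ _ hbc (hab ▸ hr)
        · exact hCtri a b c hab' hac' hbc'
  · intro K hK
    have hadj : ∀ v ∈ K, ∀ w ∈ K, v ≠ w → Rd.Adj v w := fun v hv w hw h => hK.1 hv hw h
    have hsame : ∀ v ∈ K, ∀ w ∈ K, v ≠ w → part v = part w →
        (part v).isLeft ∧ C.Adj v w := fun v hv w hw h hp =>
      (hadj v hv w hw h).elim (fun h' => absurd hp h'.1) fun h' => h'.2
    have hKr : #(K.filter fun v => (part v).isRight) ≤ e := by
      have : #(K.filter fun v => (part v).isRight) ≤ #((univ : Finset (Fin e)).map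
          (Function.Embedding.inr : Fin e ↪ Fin M ⊕ Fin e)) := by
        refine Finset.card_le_card_of_injOn part ?_ ?_
        · intro v hv
          have := (Finset.mem_filter.1 hv).2
          obtain ⟨y, hy⟩ := Sum.isRight_iff.1 this
          simp [hy]
        · intro v hv w hw hp
          by_contra h
          have h1 := (hsame v (Finset.mem_filter.1 hv).1 w (Finset.mem_filter.1 hw).1 h hp).1
          have h2 := (Finset.mem_filter.1 hv).2
          rw [Sum.isLeft_iff] at h1
          obtain ⟨y, hy⟩ := h1
          simp [hy] at h2
      simpa using this
    have hKl : #(K.filter fun v => ¬ (part v).isRight) ≤ 2 * (s - 1) := by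
      set L := K.filter fun v => ¬ (part v).isRight with hL
      -- A clique has at most two vertices in a part, as `C` is triangle-free.
      have hfib : #L ≤ 2 * #(L.image part) := by
        refine Finset.card_le_mul_card_image L 2 fun p _ => ?_
        by_contra! h
        obtain ⟨a, b, c, ha, hb, hc, hab, hac, hbc⟩ := Finset.two_lt_card_iff.1 h
        simp only [hL, Finset.mem_filter] at ha hb hc
        exact hCtri a b c (hsame a ha.1.1 b hb.1.1 hab (ha.2.trans hb.2.symm)).2
          (hsame a ha.1.1 c hc.1.1 hac (ha.2.trans hc.2.symm)).2
          (hsame b hb.1.1 c hc.1.1 hbc (hb.2.trans hc.2.symm)).2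
      have himg : #(L.image part) ≤ #(L.image part).toLeft := by
        rw [← card_toLeft_add_card_toRight (u := L.image part)]
        have : (L.image part).toRight = ∅ := by
          ext y
          simp only [mem_toRight, Finset.mem_image, hL, Finset.mem_filter]
          simp only [Finset.notMem_empty, iff_false]
          rintro ⟨v, ⟨-, hv⟩, hy⟩
          simp [hy] at hv
        simp [this]
      have hind : #(L.image part).toLeft < s := by
        by_contra! h
        obtain ⟨T, hT, hTc⟩ := Finset.exists_subset_card_eq h
        refine hR₀ T ⟨fun i hi j hj hij => ?_, hTc⟩
        obtain ⟨v, hv, hvi⟩ := Finset.mem_image.1 (mem_toLeft.1 (hT hi))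
        obtain ⟨w, hw, hwj⟩ := Finset.mem_image.1 (mem_toLeft.1 (hT hj))
        have hvw : v ≠ w := fun h => hij (by
          rw [h, hwj] at hvi; exact (Sum.inl_injective hvi).symm)
        rw [compl_adj]
        refine ⟨hij, fun hb => ?_⟩
        rcases hadj v (Finset.mem_filter.1 hv).1 w (Finset.mem_filter.1 hw).1 hvw with h | h
        · exact h.2 (by rw [hvi, hwj]; simpa [hH] using hb)
        · rw [hvi, hwj] at h
          exact hij (Sum.inl_injective h.1)
      omega
    have := Finset.card_filter_add_card_filter_not (s := K) (fun v => (part v).isRight = true)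
    have := hK.2
    omega

/-- The extremal constructions. -/
theorem exists_turanGraph_le {M e s n m : ℕ} (hM : 0 < M) (hMs : M < ramseyNumber 3 s)
    (hn : n ≤ 8 ^ m) :
    ∃ G : SimpleGraph (Fin n), MulticolourFree (cliquePair 3 (2 * s - 1 + e)) G ∧
      (G.indepNum : ℝ) ≤ (27 / 4) ^ m ∧ turanGraph n (M + e) ≤ G := by
  classical
  obtain ⟨B₀, hB₀, hR₀⟩ := exists_of_lt_ramseyNumber hMs
  obtain ⟨f⟩ : Nonempty (Fin n ↪ (Fin (3 * m) → Bool)) :=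
    Function.Embedding.nonempty_of_card_le (by
      simp only [Fintype.card_fun, Fintype.card_fin, Fintype.card_bool]
      rw [pow_mul]
      exact hn)
  let C : SimpleGraph (Fin n) := (farGraph m).comap f
  have hC : C.CliqueFree 3 :=
    (farGraph_cliqueFree m).comap (SimpleGraph.Embedding.comap f (farGraph m)).isContained
  let part : Fin n → Fin M ⊕ Fin e := fun v =>
    finSumFinEquiv.symm ⟨v % (M + e), Nat.mod_lt _ (by omega)⟩
  refine ⟨turanGraph n (M + e) ⊔ C, ?_, ?_, le_sup_left⟩
  · refine exists_colouring_of_pattern B₀ hB₀ hR₀ part C hC _ fun x y hxy hp => ?_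
    rcases hxy with hxy | hxy
    · rw [turanGraph_adj] at hxy
      simp only [part, EmbeddingLike.apply_eq_iff_eq, Fin.mk.injEq] at hp
      exact absurd hp hxy
    · exact hxy
  · obtain ⟨S, hS⟩ := (turanGraph n (M + e) ⊔ C).exists_isNIndepSet_indepNum
    rw [← hS.2, ← Finset.card_map f]
    refine card_le_of_isIndepSet_farGraph _ fun x hx y hy hxy => ?_
    obtain ⟨v, hv, rfl⟩ := Finset.mem_map.1 hx
    obtain ⟨w, hw, rfl⟩ := Finset.mem_map.1 hy
    exact hS.1 hv hw (fun h => hxy.ne (h ▸ rfl)) (Or.inr hxy)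

theorem le_two_mul_card_edgeFinset_turanGraph {N : ℕ} (hN : 0 < N) (n : ℕ) :
    (1 - 1 / (N : ℝ)) * (n : ℝ) ^ 2 - (N : ℝ) ^ 2 - 2 ≤ 2 * #(turanGraph n N).edgeFinset := by
  have h1 := card_edgeFinset_turanGraph (n := n) (r := N)
  set a := (n ^ 2 - (n % N) ^ 2) * (N - 1) with ha
  have h2 : a ≤ 2 * N * (#(turanGraph n N).edgeFinset + 1) := by
    rw [h1]
    have h3 := Nat.lt_div_mul_add (a := a) (show 0 < 2 * N by omega)
    have h4 : 2 * N * (a / (2 * N) + (n % N).choose 2 + 1) =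
      a / (2 * N) * (2 * N) + 2 * N + 2 * N * (n % N).choose 2 := by ring
    rw [h4]
    exact h3.le.trans (Nat.le_add_right _ _)
  have hmod : n % N ≤ n := Nat.mod_le _ _
  have hmod' : n % N ≤ N := (Nat.mod_lt _ hN).le
  have h3 := (Nat.cast_le (α := ℝ)).2 h2
  rw [ha, Nat.cast_mul, Nat.cast_sub (Nat.pow_le_pow_left hmod 2), Nat.cast_sub hN] at h3
  push_cast at h3
  have hN0 : (0 : ℝ) < N := by exact_mod_cast hN
  have hN1 : (1 : ℝ) ≤ N := by exact_mod_cast hN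
  have h4 : ((n % N : ℕ) : ℝ) ^ 2 ≤ (N : ℝ) ^ 2 := by
    have : ((n % N : ℕ) : ℝ) ≤ N := by exact_mod_cast hmod'
    gcongr
  have h5 : (1 - 1 / (N : ℝ)) * ((n : ℝ) ^ 2 - ((n % N : ℕ) : ℝ) ^ 2) ≤
      2 * (#(turanGraph n N).edgeFinset + 1) := by
    rw [show (1 - 1 / (N : ℝ)) * ((n : ℝ) ^ 2 - ((n % N : ℕ) : ℝ) ^ 2) =
      ((n : ℝ) ^ 2 - ((n % N : ℕ) : ℝ) ^ 2) * (N - 1) / N by field_simp, div_le_iff₀ hN0]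
    linarith
  have h6 : (0 : ℝ) ≤ 1 / N := by positivity
  have h7 : 1 / (N : ℝ) ≤ 1 := by rwa [div_le_one hN0]
  nlinarith [sq_nonneg ((n % N : ℕ) : ℝ)]

/-- The hypothesis on `ω` makes `g_s` larger than every power `n ^ (1 - ε)`. -/
theorem eventually_pow_clog_le_gFun {s : ℕ} {ω : ℕ → ℝ}
    (hω : ω =o[atTop] fun n : ℕ => Real.log n ^ (1 / (s : ℝ))) :
    ∀ᶠ n : ℕ in atTop, ((27 : ℝ) / 4) ^ Nat.clog 8 n ≤ gFun ω s n := by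
  -- 27/4 = 8 · (27/32), so κ measures the saving per factor 8 of n.
  set κ : ℝ := Real.log (32 / 27) with hκ
  have hκ0 : 0 < κ := Real.log_pos (by norm_num)
  have h8 : 0 < Real.log 8 := Real.log_pos (by norm_num)
  set η : ℝ := κ / Real.log 8 with hη
  have hη0 : 0 < η := by positivity
  have hlog : Tendsto (fun n : ℕ => Real.log n) atTop atTop :=
    Real.tendsto_log_atTop.comp tendsto_natCast_atTop_atTop
  filter_upwards [hω.bound (half_pos hη0), hlog.eventually_ge_atTop (2 * Real.log 8 / η),
    eventually_ge_atTop 2, hlog.eventually_gt_atTop 0] with n h1 h2 hn hL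
  set L : ℝ := Real.log n with hLdef
  set m := Nat.clog 8 n with hm
  have hnexp : (n : ℝ) = Real.exp L := by
    rw [hLdef, Real.exp_log (by exact_mod_cast (by omega : 0 < n))]
  have hm0 : 0 < m := Nat.clog_pos (by norm_num) hn
  have hup : (8 : ℝ) ^ m ≤ 8 * n := by
    have h3 : 8 ^ (m - 1) < n := Nat.pow_pred_clog_lt_self (by norm_num) hn
    have h4 : 8 ^ m = 8 * 8 ^ (m - 1) := by rw [← pow_succ', Nat.sub_add_cancel hm0]
    have h5 : 8 ^ m ≤ 8 * n := by rw [h4]; omega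
    exact_mod_cast h5
  have hlow : L ≤ m * Real.log 8 := by
    have h3 : n ≤ 8 ^ m := Nat.le_pow_clog (by norm_num) n
    have h4 : (n : ℝ) ≤ 8 ^ m := by exact_mod_cast h3
    rw [← Real.log_pow]
    exact Real.log_le_log (by exact_mod_cast (by omega : 0 < n)) h4
  have hωb : ω n * L ^ (1 - 1 / (s : ℝ)) ≤ η / 2 * L := by
    have h3 : ω n ≤ η / 2 * L ^ (1 / (s : ℝ)) := by
      refine (le_abs_self _).trans ?_
      rwa [Real.norm_eq_abs, Real.norm_of_nonneg (by positivity)] at h1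
    calc ω n * L ^ (1 - 1 / (s : ℝ)) ≤ η / 2 * L ^ (1 / (s : ℝ)) * L ^ (1 - 1 / (s : ℝ)) := by
          gcongr
      _ = η / 2 * L := by
          rw [mul_assoc, ← Real.rpow_add hL]
          simp
  have hpow : ((27 : ℝ) / 4) ^ m = 8 ^ m * Real.exp (-(m * κ)) := by
    rw [← mul_neg, Real.exp_nat_mul, ← mul_pow, Real.exp_neg, hκ, Real.exp_log (by norm_num)]
    norm_num
  have h2' : 2 * Real.log 8 ≤ η * L := by
    rw [div_le_iff₀ hη0] at h2; linarith
  have hmκ : η * L ≤ m * κ := by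
    rw [hη, div_mul_eq_mul_div, div_le_iff₀ h8]
    nlinarith
  unfold gFun
  rw [hpow, ← hLdef, div_eq_mul_inv, ← Real.exp_neg]
  calc (8 : ℝ) ^ m * Real.exp (-(m * κ)) ≤ 8 * n * Real.exp (-(m * κ)) := by gcongr
    _ = n * Real.exp (Real.log 8 + -(m * κ)) := by
        rw [Real.exp_add, Real.exp_log (by norm_num)]; ring
    _ ≤ _ := by
        gcongr
        linarith

/-! ### Passage to `RT` and the asymptotics. -/

theorem bddAbove_ncard_edgeSet {n : ℕ} (p : SimpleGraph (Fin n) → Prop) :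
    BddAbove {e : ℕ | ∃ G, p G ∧ G.edgeSet.ncard = e} := by
  refine (Set.Finite.subset (Set.finite_range fun G : SimpleGraph (Fin n) => G.edgeSet.ncard)
    ?_).bddAbove
  rintro e ⟨G, -, rfl⟩
  exact ⟨G, rfl⟩

theorem ncard_edgeSet_le_RT {n k : ℕ} {W : Fin k → Type} {H : ∀ i, SimpleGraph (W i)} {m : ℝ}
    {G : SimpleGraph (Fin n)} (hG : MulticolourFree H G) (hα : (G.indepNum : ℝ) ≤ m) :
    G.edgeSet.ncard ≤ RT n H m := by
  refine le_csSup ?_ ⟨G, hG, hα, rfl⟩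
  simpa only [and_assoc] using bddAbove_ncard_edgeSet
    (fun G : SimpleGraph (Fin n) => MulticolourFree H G ∧ (G.indepNum : ℝ) ≤ m)

/-- The nonvanishing rules out the default value `sSup ∅ = 0`, taken when no graph is admissible. -/
theorem exists_ncard_edgeSet_eq_RT {n k : ℕ} {W : Fin k → Type} {H : ∀ i, SimpleGraph (W i)}
    {m : ℝ} (hRT : RT n H m ≠ 0) : ∃ G : SimpleGraph (Fin n),
      MulticolourFree H G ∧ (G.indepNum : ℝ) ≤ m ∧ G.edgeSet.ncard = RT n H m := by
  refine Nat.sSup_mem (s := {e : ℕ | ∃ G : SimpleGraph (Fin n),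
    MulticolourFree H G ∧ (G.indepNum : ℝ) ≤ m ∧ G.edgeSet.ncard = e}) ?_ ?_
  · rw [Set.nonempty_iff_ne_empty]
    intro h
    exact hRT (by rw [RT, h]; simp)
  · simpa only [and_assoc] using bddAbove_ncard_edgeSet
      (fun G : SimpleGraph (Fin n) => MulticolourFree H G ∧ (G.indepNum : ℝ) ≤ m)

theorem eventually_le_RT {s : ℕ} (hs : 2 ≤ s) (e : ℕ) {ω : ℕ → ℝ}
    (hω : ω =o[atTop] fun n : ℕ => Real.log n ^ (1 / (s : ℝ))) {ε : ℝ} (hε : 0 < ε) :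
    ∀ᶠ n : ℕ in atTop,
      (1 - 1 / ((ramseyNumber 3 s + e - 1 : ℕ) : ℝ) - ε) * (n : ℝ) ^ 2 ≤
        2 * (RT n (cliquePair 3 (2 * s - 1 + e)) (gFun ω s n) : ℝ) := by
  have hR := three_le_ramseyNumber hs
  set N := ramseyNumber 3 s + e - 1 with hN
  have hsq : Tendsto (fun n : ℕ => ε * (n : ℝ) ^ 2) atTop atTop :=
    ((tendsto_pow_atTop two_ne_zero).comp tendsto_natCast_atTop_atTop).const_mul_atTop hε
  filter_upwards [eventually_pow_clog_le_gFun hω,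
    hsq.eventually_ge_atTop ((N : ℝ) ^ 2 + 2)] with n hg hn
  obtain ⟨G, hG, hα, hle⟩ := exists_turanGraph_le (M := ramseyNumber 3 s - 1) (e := e) (s := s)
    (by omega) (by omega) (Nat.le_pow_clog (show 1 < 8 by norm_num) n)
  rw [show ramseyNumber 3 s - 1 + e = N by omega] at hle
  have h1 := ncard_edgeSet_le_RT hG (hα.trans hg)
  have h2 : #(turanGraph n N).edgeFinset ≤ G.edgeSet.ncard := by
    rw [← Set.ncard_coe_finset, coe_edgeFinset]
    exact Set.ncard_le_ncard (edgeSet_mono hle) (Set.toFinite _)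
  have h3 := le_two_mul_card_edgeFinset_turanGraph (N := N) (by omega) n
  have h4 : (#(turanGraph n N).edgeFinset : ℝ) ≤
      RT n (cliquePair 3 (2 * s - 1 + e)) (gFun ω s n) := by exact_mod_cast h2.trans h1
  linarith

theorem eventually_RT_le {s : ℕ} (hs : 2 ≤ s) {e : ℕ} (he : e ≤ 1) {ω : ℕ → ℝ}
    (hω : Tendsto ω atTop atTop) {ε : ℝ} (hε : 0 < ε) :
    ∀ᶠ n : ℕ in atTop, 2 * (RT n (cliquePair 3 (2 * s - 1 + e)) (gFun ω s n) : ℝ) ≤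
      (1 - 1 / ((ramseyNumber 3 s + e - 1 : ℕ) : ℝ) + ε) * (n : ℝ) ^ 2 := by
  obtain ⟨K, hK⟩ := eventually_card_adj_lt hs he hε
  have hR := three_le_ramseyNumber hs
  filter_upwards [hK, hω.eventually_ge_atTop K, eventually_ge_atTop 1] with n hn hKn hn1
  by_cases h0 : RT n (cliquePair 3 (2 * s - 1 + e)) (gFun ω s n) = 0
  · rw [h0, Nat.cast_zero, mul_zero]
    have h1 : (1 : ℝ) ≤ ((ramseyNumber 3 s + e - 1 : ℕ) : ℝ) := by
      exact_mod_cast (by omega : 1 ≤ ramseyNumber 3 s + e - 1)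
    have h2 : 1 / ((ramseyNumber 3 s + e - 1 : ℕ) : ℝ) ≤ 1 := by
      rwa [div_le_one (by linarith)]
    have h3 : 0 ≤ 1 - 1 / ((ramseyNumber 3 s + e - 1 : ℕ) : ℝ) + ε := by linarith
    positivity
  · obtain ⟨G, hG, hα, hcard⟩ := exists_ncard_edgeSet_eq_RT h0
    obtain ⟨B, R, hBR, hB, hRf⟩ := (multicolourFree_cliquePair_iff G).1 hG
    rw [← hcard]
    refine (hn G B R hBR hB hRf (hα.trans ?_)).le
    unfold gFun
    have : 0 ≤ Real.log n := Real.log_natCast_nonneg n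
    gcongr

theorem isLittleO_RT_sub {s : ℕ} (hs : 2 ≤ s) {e : ℕ} (he : e ≤ 1) {ω : ℕ → ℝ}
    (hω : Tendsto ω atTop atTop)
    (hω_slow : ω =o[atTop] fun n : ℕ => Real.log n ^ (1 / (s : ℝ))) :
    (fun n : ℕ => (RT n (cliquePair 3 (2 * s - 1 + e)) (gFun ω s n) : ℝ)
      - 1 / 2 * (1 - 1 / ((ramseyNumber 3 s + e - 1 : ℕ) : ℝ)) * (n : ℝ) ^ 2)
      =o[atTop] fun n : ℕ => (n : ℝ) ^ 2 := by
  rw [isLittleO_iff]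
  intro ε hε
  filter_upwards [eventually_RT_le hs he hω hε, eventually_le_RT hs e hω_slow hε] with n h1 h2
  have h3 : 0 ≤ (n : ℝ) ^ 2 := by positivity
  rw [Real.norm_eq_abs, Real.norm_of_nonneg h3, abs_le]
  have h4 : 0 ≤ ε * (n : ℝ) ^ 2 := by positivity
  constructor <;> linarith

end RamseyTuran

theorem theorem1p2 (s : ℕ) (hs : 2 ≤ s) (ω : ℕ → ℝ)
    (hω : Tendsto ω atTop atTop)
    (hω_slow : ω =o[atTop] fun n : ℕ => Real.log n ^ (1 / (s : ℝ))) :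
    ((fun n : ℕ =>
        (RamseyTuran.RT n (RamseyTuran.cliquePair 3 (2 * s - 1)) (RamseyTuran.gFun ω s n) : ℝ)
          - 1 / 2 * (1 - 1 / ((RamseyTuran.ramseyNumber 3 s : ℝ) - 1)) * (n : ℝ) ^ 2)
      =o[atTop] fun n : ℕ => (n : ℝ) ^ 2) ∧
    ((fun n : ℕ =>
        (RamseyTuran.RT n (RamseyTuran.cliquePair 3 (2 * s)) (RamseyTuran.gFun ω s n) : ℝ)
          - 1 / 2 * (1 - 1 / (RamseyTuran.ramseyNumber 3 s : ℝ)) * (n : ℝ) ^ 2)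
      =o[atTop] fun n : ℕ => (n : ℝ) ^ 2) := by
  have hR := RamseyTuran.three_le_ramseyNumber hs
  have h0 := RamseyTuran.isLittleO_RT_sub hs (e := 0) (by norm_num) hω hω_slow
  have h1 := RamseyTuran.isLittleO_RT_sub hs (e := 1) le_rfl hω hω_slow
  rw [add_zero, add_zero, Nat.cast_sub (by omega), Nat.cast_one] at h0
  rw [Nat.sub_add_cancel (by omega), Nat.add_sub_cancel] at h1
  exact ⟨h0, h1⟩
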